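/- Throughout, manifolds, maps, bundles and actions are smooth. Let $Spin(k)$ be the group of products of an even number of unit vectors in the Clifford algebra of $\mathbb{R}^k$ with $v^2=-\|v\|^2$, let $\lambda(x)\in SO(k)$ be the rotation $y\mapsto x\,y\,x^t$ for $x\in Spin(k)$ (where $x^t$ is the reversal of $x$), and let $Spin^c(k)=(Spin(k)\times U(1))/\{(1,1),(-1,-1)\}$. Let $M$ be a compact oriented Riemannian manifold of dimension $2m$, and let the torus $T=\mathbb{T}^n=(S^1)^n$ act on $M$ by isometries. Let $P\to SOF(M)$ be a $T$-equivariant spin$^c$ structure on $M$; that is, $P\to M$ is a principal $Spin^c(2m)$-bundle with a map $\Lambda$ over $M$ to the bundle $SOF(M)$ of oriented orthonormal frames such that $\Lambda(p\cdot[x,z])=\Lambda(p)\cdot\lambda(x)$, and $T$ acts on $P$, over its action on $M$, commuting with the action of $Spin^c(2m)$, so that $\Lambda$ is $T$-equivariant. Let $\mathbb{L}=P\times_{Spin^c(2m)}\mathbb{C}$ be its determinant line bundle, where $[x,z]$ acts on $\mathbb{C}$ as multiplication by $z^2$; it carries the $T$-action $t\cdot[p,w]=[t\cdot p,w]$. Write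 $e^{i\theta}=(e^{i\theta_1},\dots,e^{i\theta_n})\in T$ for $\theta\in\mathfrak{t}=Lie(T)=\mathbb{R}^n$. A functional $\beta\in\mathfrak{t}^*$ is in the weight lattice of $T$ if $e^{i\theta}\mapsto e^{i\beta(\theta)}$ is a well-defined continuous homomorphism $T\to S^1$. **Lemma.** Let $x\in M^T$ be a fixed point, and let $J:T_xM\to T_xM$ be a $T$-invariant complex structure. Let $\alpha_1,\dots,\alpha_m\in\mathfrak{t}^*$ be the weights, with multiplicity, of the $T$-action on the complex vector space $(T_xM,J)$: there is a complex basis $e_1,\dots,e_m$ of $(T_xM,J)$ such that $e^{i\theta}$ acts on $e_j$ as multiplication by $e^{i\alpha_j(\theta)}$. Let $\mu\in\mathfrak{t}^*$ be the weight of the $T$-action on the fibre $\mathbb{L}_x$: $e^{i\theta}$ acts on $\mathbb{L}_x$ as multiplication by $e^{i\mu(\theta)}$. Then $$\tfrac12\Big(\mu-\sum_{j=1}^m\alpha_j\Big)$$ is in the weight lattice of $T$. -/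

import Mathlib

open scoped Manifold ContDiff TensorProduct

noncomputable section

/-! ### The groups `Spin(k)` and `Spin^c(k)` -/

/-- The quadratic form `v ↦ -‖v‖²` on `ℝ^k`, so that `v * v = -‖v‖²` in its Clifford algebra. -/
def negNormForm (k : ℕ) : QuadraticForm ℝ (EuclideanSpace ℝ (Fin k)) :=
  LinearMap.BilinMap.toQuadraticMap (-(innerₗ (EuclideanSpace ℝ (Fin k))))

/-- The real Clifford algebra `C_k` of `ℝ^k` with minus the standard inner product. -/
abbrev Cl (k : ℕ) : Type := CliffordAlgebra (negNormForm k)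

/-- `Spin(k) ⊂ C_k`, the group of products of an even number of unit vectors. -/
abbrev Spin (k : ℕ) : Type := spinGroup (negNormForm k)

/-- The subgroup `K = {(1, 1), (-1, -1)}` of `Spin(k) × U(1)`. -/
def spinCKernel (k : ℕ) : Subgroup (Spin k × Circle) where
  carrier := {p | ((p.1 : Cl k) = 1 ∧ (p.2 : ℂ) = 1) ∨ ((p.1 : Cl k) = -1 ∧ (p.2 : ℂ) = -1)}
  one_mem' := by left; simp
  mul_mem' := by
    have key (a b : Spin k × Circle) : (((a * b).1 : Spin k) : Cl k) = (a.1 : Cl k) * b.1 ∧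
        (((a * b).2 : Circle) : ℂ) = a.2 * b.2 := ⟨rfl, rfl⟩
    rintro a b (⟨h1, h2⟩ | ⟨h1, h2⟩) (⟨h3, h4⟩ | ⟨h3, h4⟩)
    · left; rw [(key a b).1, (key a b).2, h1, h2, h3, h4]; simp
    · right; rw [(key a b).1, (key a b).2, h1, h2, h3, h4]; simp
    · right; rw [(key a b).1, (key a b).2, h1, h2, h3, h4]; simp
    · left; rw [(key a b).1, (key a b).2, h1, h2, h3, h4]; simp
  inv_mem' := by
    rintro a (⟨h1, h2⟩ | ⟨h1, h2⟩)
    · left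
      refine ⟨?_, by simp [h2]⟩
      rw [Prod.fst_inv, ← spinGroup.star_eq_inv, spinGroup.coe_star, h1, star_one]
    · right
      refine ⟨?_, by rw [Prod.snd_inv, Circle.coe_inv, h2]; norm_num⟩
      rw [Prod.fst_inv, ← spinGroup.star_eq_inv, spinGroup.coe_star, h1, star_neg, star_one]

instance spinCKernel_normal (k : ℕ) : (spinCKernel k).Normal where
  conj_mem a ha b := by
    have hb : ((b.1 : Cl k)) * ((b.1⁻¹ : Spin k) : Cl k) = 1 := by
      rw [← Submonoid.coe_mul, mul_inv_cancel, Submonoid.coe_one]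
    have hc : (b.2 : ℂ) ≠ 0 := Circle.coe_ne_zero _
    rcases ha with ⟨h1, h2⟩ | ⟨h1, h2⟩
    · left; simp [h1, h2, hb]
    · right; simp [h1, h2, hb]

/-- `Spin^c(k) = (Spin(k) × U(1)) / {(1, 1), (-1, -1)}`. -/
abbrev SpinC (k : ℕ) : Type := (Spin k × Circle) ⧸ spinCKernel k

/-- The character `[x, z] ↦ z²` of `Spin^c(k)`. -/
def spinCDet (k : ℕ) : SpinC k →* Circle :=
  QuotientGroup.lift (spinCKernel k)
    ((powMonoidHom 2 : Circle →* Circle).comp (MonoidHom.snd (Spin k) Circle)) (by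
      rintro a (⟨-, h⟩ | ⟨-, h⟩) <;>
        · rw [MonoidHom.mem_ker]
          apply Circle.ext
          simp [h])

/-- The embedding `[x, z] ↦ z ⊗ x` of `Spin^c(k)` into the complex Clifford algebra
`C_k^c = ℂ ⊗ C_k`. -/
def spinCToAlg (k : ℕ) : SpinC k →* ℂ ⊗[ℝ] Cl k :=
  QuotientGroup.lift (spinCKernel k)
    { toFun := fun p => (p.2 : ℂ) ⊗ₜ[ℝ] (p.1 : Cl k)
      map_one' := by simp [Algebra.TensorProduct.one_def]
      map_mul' := fun a b => by simp } (by
      rintro a (⟨h1, h2⟩ | ⟨h1, h2⟩) <;>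
        · rw [MonoidHom.mem_ker]
          change (a.2 : ℂ) ⊗ₜ[ℝ] (a.1 : Cl k) = 1
          simp [h1, h2, Algebra.TensorProduct.one_def, TensorProduct.neg_tmul,
            TensorProduct.tmul_neg])

/-- The linear projection `C_k → ℝ^k` onto the vectors, a left inverse of the inclusion. -/
def clVectorPart (k : ℕ) : Cl k →ₗ[ℝ] EuclideanSpace ℝ (Fin k) :=
  ExteriorAlgebra.ιInv ∘ₗ (CliffordAlgebra.equivExterior (negNormForm k)).toLinearMap

lemma clVectorPart_ι (k : ℕ) (v : EuclideanSpace ℝ (Fin k)) :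
    clVectorPart k (CliffordAlgebra.ι (negNormForm k) v) = v := by
  have h : CliffordAlgebra.equivExterior (negNormForm k) (CliffordAlgebra.ι (negNormForm k) v)
      = ExteriorAlgebra.ι ℝ v :=
    CliffordAlgebra.changeForm_ι CliffordAlgebra.changeForm.associated_neg_proof v
  simp only [clVectorPart, LinearMap.comp_apply, LinearEquiv.coe_coe, h]
  exact ExteriorAlgebra.ι_leftInverse v

/-- The linear map `y ↦ x y xᵗ` of `ℝ^k`, for `x ∈ Spin(k)`; here `xᵗ` is the reversal of `x`. -/
def spinRotation {k : ℕ} (x : Spin k) :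
    EuclideanSpace ℝ (Fin k) →ₗ[ℝ] EuclideanSpace ℝ (Fin k) :=
  clVectorPart k ∘ₗ LinearMap.mulLeft ℝ (x : Cl k) ∘ₗ
    LinearMap.mulRight ℝ (CliffordAlgebra.reverse (x : Cl k)) ∘ₗ
      CliffordAlgebra.ι (negNormForm k)

lemma ι_spinRotation {k : ℕ} (x : Spin k) (y : EuclideanSpace ℝ (Fin k)) :
    CliffordAlgebra.ι (negNormForm k) (spinRotation x y) =
      (x : Cl k) * CliffordAlgebra.ι (negNormForm k) y * CliffordAlgebra.reverse (x : Cl k) := by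
  have hmem : ((spinGroup.toUnits x : (Cl k)ˣ) : Cl k) ∈ spinGroup (negNormForm k) := x.2
  have h := spinGroup.conjAct_smul_ι_mem_range_ι hmem y
  have hrev : ((x⁻¹ : Spin k) : Cl k) = CliffordAlgebra.reverse (x : Cl k) := by
    rw [← spinGroup.star_eq_inv, spinGroup.coe_star, CliffordAlgebra.star_def,
      spinGroup.involute_eq x.2]
  rw [ConjAct.units_smul_def, ConjAct.ofConjAct_toConjAct] at h
  obtain ⟨w, hw⟩ := h
  have hw' : CliffordAlgebra.ι (negNormForm k) w =
      (x : Cl k) * CliffordAlgebra.ι (negNormForm k) y *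
        CliffordAlgebra.reverse (x : Cl k) := by
    rw [hw, ← hrev]; rfl
  have : spinRotation x y = w := by
    rw [← clVectorPart_ι k w, hw']
    simp [spinRotation, mul_assoc]
  rw [this, hw']

/-- The homomorphism `λ^c : [x, z] ↦ λ(x) = (y ↦ x y xᵗ)` from `Spin^c(k)` to the linear maps of
`ℝ^k`; its image is `SO(k)`. -/
def spinCRotation {k : ℕ} : SpinC k →* Module.End ℝ (EuclideanSpace ℝ (Fin k)) :=
  QuotientGroup.lift (spinCKernel k)
    { toFun := fun p => spinRotation p.1
      map_one' := by
        ext1 y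
        simp [spinRotation, clVectorPart_ι]
      map_mul' := fun a b => by
        ext1 y
        apply (Function.LeftInverse.injective (clVectorPart_ι k))
        simp [ι_spinRotation, mul_assoc] } (by
      rintro a (⟨h1, -⟩ | ⟨h1, -⟩) <;>
        · rw [MonoidHom.mem_ker]
          ext1 y
          simp [spinRotation, h1, clVectorPart_ι])

/-- Smoothness on a set of a map into `Spin^c(k)`, which is a compact (hence embedded) Lie subgroup
of the group of units of the finite-dimensional algebra `C_k^c`: all coordinates in `C_k^c` are
smooth. -/
def SpinCSmoothOn {k : ℕ} {E H N : Type*} [NormedAddCommGroup E] [NormedSpace ℝ E]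
    [TopologicalSpace H] (I : ModelWithCorners ℝ E H) [TopologicalSpace N] [ChartedSpace H N]
    (h : N → SpinC k) (s : Set N) : Prop :=
  ∀ ℓ : (ℂ ⊗[ℝ] Cl k) →ₗ[ℝ] ℝ, ContMDiffOn I 𝓘(ℝ, ℝ) ∞ (fun y => ℓ (spinCToAlg k (h y))) s

/-! ### The torus and its weights -/

/-- The `n`-dimensional torus `𝕋^n = (S¹)^n`. -/
abbrev Torus (n : ℕ) : Type := Fin n → Circle

/-- The model of the torus as a product manifold. -/
abbrev torusModel (n : ℕ) :
    ModelWithCorners ℝ (Fin n → EuclideanSpace ℝ (Fin 1))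
      (ModelPi fun _ : Fin n => EuclideanSpace ℝ (Fin 1)) :=
  ModelWithCorners.pi fun _ : Fin n => 𝓡 1

/-- The exponential map `θ ↦ (e^{iθ_1}, …, e^{iθ_n})` from `Lie(𝕋^n) = ℝ^n` to `𝕋^n`. -/
def torusExp {n : ℕ} (θ : Fin n → ℝ) : Torus n := fun i => Circle.exp (θ i)

/-- The weight lattice of `𝕋^n` in `Lie(𝕋^n)^*`: the functionals `β` for which
`e^{iθ} ↦ e^{iβ(θ)}` is a well-defined continuous character `𝕋^n → S¹`. -/
def weightLattice (n : ℕ) : AddSubgroup (Module.Dual ℝ (Fin n → ℝ)) where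
  carrier := {β | ∃ χ : Torus n →* Circle, Continuous χ ∧
    ∀ θ : Fin n → ℝ, χ (torusExp θ) = Circle.exp (β θ)}
  zero_mem' := ⟨1, continuous_const, fun θ => by simp⟩
  add_mem' := by
    rintro β γ ⟨χ, hχ, h⟩ ⟨ψ, hψ, h'⟩
    exact ⟨χ * ψ, hχ.mul hψ, fun θ => by simp [h, h', Circle.exp_add]⟩
  neg_mem' := by
    rintro β ⟨χ, hχ, h⟩
    exact ⟨χ⁻¹, hχ.inv, fun θ => by simp [h, Circle.exp_neg]⟩

/-! ### Oriented Riemannian manifolds -/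

section Manifold

variable {k : ℕ} {M : Type*} [TopologicalSpace M] [ChartedSpace (EuclideanSpace ℝ (Fin k)) M]
  [IsManifold (𝓡 k) ∞ M]

/-- A choice of orientations of the tangent spaces is an orientation of the manifold if around every
point there is a smooth local frame of the tangent bundle that is positively oriented. -/
def IsManifoldOrientation (o : ∀ x : M, Orientation ℝ (TangentSpace (𝓡 k) x) (Fin k)) : Prop :=
  ∀ x₀ : M, ∃ U : Set M, IsOpen U ∧ x₀ ∈ U ∧
    ∃ b : ∀ x : M, Module.Basis (Fin k) ℝ (TangentSpace (𝓡 k) x),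
      (∀ i, ContMDiffOn (𝓡 k) (𝓡 k).tangent ∞
        (fun x => (⟨x, b x i⟩ : TangentBundle (𝓡 k) M)) U) ∧
      ∀ x ∈ U, (b x).orientation = o x

/-- Smooth Riemannian metrics on `M`. -/
abbrev RiemMetric (k : ℕ) (M : Type*) [TopologicalSpace M]
    [ChartedSpace (EuclideanSpace ℝ (Fin k)) M] [IsManifold (𝓡 k) ∞ M] :=
  Bundle.ContMDiffRiemannianMetric (𝓡 k) ∞ (EuclideanSpace ℝ (Fin k))
    (fun x : M => TangentSpace (𝓡 k) x)

/-- The set `SOF(M)` of oriented orthonormal frames, a frame at `x` being an orientation-preserving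
linear isometry from `ℝ^k` to `T_xM`. -/
structure SOFrame (g : RiemMetric k M)
    (o : ∀ x : M, Orientation ℝ (TangentSpace (𝓡 k) x) (Fin k)) where
  base : M
  frame : EuclideanSpace ℝ (Fin k) ≃ₗ[ℝ] TangentSpace (𝓡 k) base
  isometry : ∀ v w, g.inner base (frame v) (frame w) = inner ℝ v w
  oriented : Orientation.map (Fin k) frame
    (EuclideanSpace.basisFun (Fin k) ℝ).toBasis.orientation = o base

/-- The action of the group on `M` is by isometries of the Riemannian metric. -/
def ActsByIsometries (G : Type*) [Group G] [MulAction G M] (g : RiemMetric k M) : Prop :=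
  ∀ (t : G) (x : M) (v w : TangentSpace (𝓡 k) x),
    g.inner (t • x) (mfderiv (𝓡 k) (𝓡 k) (fun y : M => t • y) x v)
      (mfderiv (𝓡 k) (𝓡 k) (fun y : M => t • y) x w) = g.inner x v w

/-! ### Spin^c structures and their determinant line bundles -/

/-- A `Spin^c` structure with total space `P` on the oriented Riemannian manifold `M`: a smooth
principal `Spin^c(k)`-bundle `P → M` with a smooth map `Λ : P → SOF(M)` over `M` that intertwines
the principal actions along `λ^c`.

The smooth structure of `P` is given by an atlas of local sections `s : U → P` that differ by smooth
`Spin^c(k)`-valued functions; the local trivializations are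
`U × Spin^c(k) → P, (x, h) ↦ s(x) · h`. -/
structure SpinCStructure (g : RiemMetric k M)
    (o : ∀ x : M, Orientation ℝ (TangentSpace (𝓡 k) x) (Fin k)) (P : Type*) where
  /-- the bundle projection -/
  proj : P → M
  /-- the principal right action -/
  act : P → SpinC k → P
  act_one : ∀ p, act p 1 = p
  act_mul : ∀ p a b, act p (a * b) = act (act p a) b
  proj_act : ∀ p a, proj (act p a) = proj p
  /-- the action is free and transitive on the fibres -/
  existsUnique_act : ∀ p q, proj p = proj q → ∃! a, act p a = q
  /-- the atlas of smooth local sections (only the values on the open set matter) -/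
  sections : Set (Set M × (M → P))
  isOpen_dom : ∀ σ ∈ sections, IsOpen σ.1
  proj_section : ∀ σ ∈ sections, ∀ x ∈ σ.1, proj (σ.2 x) = x
  cover : ∀ x, ∃ σ ∈ sections, x ∈ σ.1
  smooth_transition : ∀ σ ∈ sections, ∀ τ ∈ sections, ∃ h : M → SpinC k,
    SpinCSmoothOn (𝓡 k) h (σ.1 ∩ τ.1) ∧ ∀ x ∈ σ.1 ∩ τ.1, τ.2 x = act (σ.2 x) (h x)
  /-- the map `Λ : P → SOF(M)` -/
  toFrame : P → SOFrame g o
  base_toFrame : ∀ p, (toFrame p).base = proj p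
  toFrame_act : ∀ (p : P) (a : SpinC k) (v : EuclideanSpace ℝ (Fin k)),
    (⟨(toFrame (act p a)).base, (toFrame (act p a)).frame v⟩ : TangentBundle (𝓡 k) M) =
      ⟨(toFrame p).base, (toFrame p).frame (spinCRotation a v)⟩
  smooth_toFrame : ∀ σ ∈ sections, ∀ v : EuclideanSpace ℝ (Fin k),
    ContMDiffOn (𝓡 k) (𝓡 k).tangent ∞
      (fun x => (⟨(toFrame (σ.2 x)).base, (toFrame (σ.2 x)).frame v⟩ :
        TangentBundle (𝓡 k) M)) σ.1

/-- A `𝕋^n`-equivariant `Spin^c` structure on the oriented Riemannian manifold `M` with an isometric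
`𝕋^n`-action: `𝕋^n` acts smoothly on `P` over its action on `M`, commuting with the principal action,
and `Λ` is equivariant for the action `t · (x, f) = (t · x, dt ∘ f)` on `SOF(M)`. -/
structure EquivariantSpinCStructure (n : ℕ) [MulAction (Torus n) M] (g : RiemMetric k M)
    (o : ∀ x : M, Orientation ℝ (TangentSpace (𝓡 k) x) (Fin k)) (P : Type*)
    extends SpinCStructure g o P where
  /-- the left action of the torus -/
  tsmul : Torus n → P → P
  one_tsmul : ∀ p, tsmul 1 p = p
  mul_tsmul : ∀ t u p, tsmul (t * u) p = tsmul t (tsmul u p)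
  proj_tsmul : ∀ t p, proj (tsmul t p) = t • proj p
  tsmul_act : ∀ t p a, tsmul t (act p a) = act (tsmul t p) a
  toFrame_tsmul : ∀ (t : Torus n) (p : P) (v : EuclideanSpace ℝ (Fin k)),
    (⟨(toFrame (tsmul t p)).base, (toFrame (tsmul t p)).frame v⟩ : TangentBundle (𝓡 k) M) =
      ⟨t • (toFrame p).base,
        mfderiv (𝓡 k) (𝓡 k) (fun y : M => t • y) (toFrame p).base ((toFrame p).frame v)⟩
  /-- the action map `𝕋^n × P → P` is smooth, in the local trivializations -/
  smooth_tsmul : ∀ σ ∈ sections, ∀ τ ∈ sections, ∃ h : Torus n × M → SpinC k,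
    SpinCSmoothOn ((torusModel n).prod (𝓡 k)) h {q | q.2 ∈ σ.1 ∧ q.1 • q.2 ∈ τ.1} ∧
    ∀ q : Torus n × M, q.2 ∈ σ.1 → q.1 • q.2 ∈ τ.1 →
      tsmul q.1 (σ.2 q.2) = act (τ.2 (q.1 • q.2)) (h q)

section DetLine

variable {g : RiemMetric k M} {o : ∀ x : M, Orientation ℝ (TangentSpace (𝓡 k) x) (Fin k)}
  {P : Type*}

/-- The relation `(p · a, w) ∼ (p, det(a) w)` on `P × ℂ`, where `det [x, z] = z²`. -/
def SpinCStructure.detSetoid (S : SpinCStructure g o P) : Setoid (P × ℂ) where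
  r u v := ∃ a : SpinC k, u.1 = S.act v.1 a ∧ v.2 = (spinCDet k a : ℂ) * u.2
  iseqv :=
    { refl := fun u => ⟨1, by simp [S.act_one], by simp⟩
      symm := by
        rintro u v ⟨a, h1, h2⟩
        refine ⟨a⁻¹, by rw [h1, ← S.act_mul, mul_inv_cancel, S.act_one], ?_⟩
        rw [h2, ← mul_assoc, ← Circle.coe_mul, ← map_mul]
        simp
      trans := by
        rintro u v w ⟨a, h1, h2⟩ ⟨b, h3, h4⟩
        exact ⟨b * a, by rw [h1, h3, S.act_mul], by rw [h4, h2]; simp [mul_assoc]⟩ }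

/-- The total space of the determinant line bundle `𝕃 = P ×_{Spin^c(k)} ℂ`, where `[x, z]` acts on
`ℂ` by `z²`. -/
def SpinCStructure.DetLine (S : SpinCStructure g o P) : Type _ := Quotient S.detSetoid

/-- The projection `𝕃 → M`. -/
def SpinCStructure.detProj (S : SpinCStructure g o P) : S.DetLine → M :=
  Quotient.lift (fun u : P × ℂ => S.proj u.1) (by
    rintro u v ⟨a, h1, -⟩
    simp only [h1, S.proj_act])

/-- Scalar multiplication `c · [p, w] = [p, c w]` in the fibres of `𝕃`. -/
def SpinCStructure.detScale (S : SpinCStructure g o P) (c : ℂ) : S.DetLine → S.DetLine :=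
  Quotient.map (fun u : P × ℂ => (u.1, c * u.2)) (by
    rintro u v ⟨a, h1, h2⟩
    exact ⟨a, h1, by simp only [h2]; ring⟩)

/-- The action `t · [p, w] = [t · p, w]` of the torus on `𝕃`. -/
def EquivariantSpinCStructure.detSmul {n : ℕ} [MulAction (Torus n) M]
    (S : EquivariantSpinCStructure n g o P) (t : Torus n) :
    S.toSpinCStructure.DetLine → S.toSpinCStructure.DetLine :=
  Quotient.map (fun u : P × ℂ => (S.tsmul t u.1, u.2)) (by
    rintro u v ⟨a, h1, h2⟩
    exact ⟨a, by simp only [h1, S.tsmul_act], h2⟩)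

/-- `μ` is the weight of the torus on the fibre `𝕃_x` over a fixed point `x`: the element `e^{iθ}`
acts on `𝕃_x` as multiplication by `e^{iμ(θ)}`. -/
def EquivariantSpinCStructure.IsDetWeight {n : ℕ} [MulAction (Torus n) M]
    (S : EquivariantSpinCStructure n g o P) (x : M) (μ : Module.Dual ℝ (Fin n → ℝ)) : Prop :=
  ∀ (θ : Fin n → ℝ) (ℓ : S.toSpinCStructure.DetLine), S.toSpinCStructure.detProj ℓ = x →
    S.detSmul (torusExp θ) ℓ = S.toSpinCStructure.detScale (Circle.exp (μ θ) : ℂ) ℓ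

end DetLine

end Manifold

/-! ### Isotropy weights -/

section Isotropy

variable {k n : ℕ} {M : Type*} [TopologicalSpace M]
  [ChartedSpace (EuclideanSpace ℝ (Fin k)) M] [MulAction (Torus n) M]

/-- The isotropy action of the torus on the tangent space of a fixed point `x`: the differential
`T_xM → T_{t • x}M` of the action of `t`, where `t • x = x`. -/
def isotropyMap (x : M) (hx : x ∈ MulAction.fixedPoints (Torus n) M) (t : Torus n) :
    TangentSpace (𝓡 k) x →L[ℝ] TangentSpace (𝓡 k) x :=
  (congrArg (fun y : M => TangentSpace (𝓡 k) x →L[ℝ] TangentSpace (𝓡 k) y) (hx t)).mp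
    (mfderiv (𝓡 k) (𝓡 k) (fun y : M => t • y) x)

/-- `J` is a complex structure on `T_xM` that is invariant under the isotropy action. -/
def IsInvariantComplexStructure (x : M) (hx : x ∈ MulAction.fixedPoints (Torus n) M)
    (J : TangentSpace (𝓡 k) x →ₗ[ℝ] TangentSpace (𝓡 k) x) : Prop :=
  (∀ v, J (J v) = -v) ∧
    ∀ (t : Torus n) (v : TangentSpace (𝓡 k) x), J (isotropyMap x hx t v) = isotropyMap x hx t (J v)

/-- `α_1, …, α_m` are the weights (with multiplicity) of the torus on the complex vector space
`(T_xM, J)`: there is a complex basis `e_1, …, e_m`, that is, a real basis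
`e_1, …, e_m, J e_1, …, J e_m`, such that `e^{iθ}` acts on `e_j` as multiplication by
`e^{iα_j(θ)}`. -/
def IsIsotropyWeights {m : ℕ} (x : M) (hx : x ∈ MulAction.fixedPoints (Torus n) M)
    (J : TangentSpace (𝓡 k) x →ₗ[ℝ] TangentSpace (𝓡 k) x)
    (α : Fin m → Module.Dual ℝ (Fin n → ℝ)) : Prop :=
  ∃ e : Fin m → TangentSpace (𝓡 k) x,
    (∃ b : Module.Basis (Fin m ⊕ Fin m) ℝ (TangentSpace (𝓡 k) x),
      ⇑b = Sum.elim e (fun j => J (e j))) ∧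
    ∀ (θ : Fin n → ℝ) (j : Fin m),
      isotropyMap x hx (torusExp θ) (e j) =
        Real.cos (α j θ) • e j + Real.sin (α j θ) • J (e j)

end Isotropy

end

/-! # Weights of a `Spin^c` structure at a fixed point

It suffices to show that `β = (μ - ∑ αⱼ) / 2` takes values in `2πℤ` on each generator `2η` of the
kernel of the exponential map of the torus (`mem_weightLattice_of_exp_two_pi`).

Fix a point `p` of `P` over the fixed point `x`, and write `exp(η) · p = p · [y, z]`. Then:

* `[y, z]² = 1`, because `exp(2η) = 1`; so `(y², z²)` is `(1, 1)` or `(-1, -1)`;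
* `z² = e^{iμ(η)}`, by the action on the fibre of the determinant line bundle
  (`EquivariantSpinCStructure.IsDetWeight.det_eq`);
* the rotation `λ(y)` is conjugate to the isotropy action of `exp(η)`
  (`EquivariantSpinCStructure.exists_frame`). As `αⱼ(2η) ∈ 2πℤ`, it acts on `eⱼ` and on `J eⱼ` by
  the same sign `cos αⱼ(η) = e^{iαⱼ(η)}`.

So `λ(y)` is an orthogonal involution whose `(-1)`-eigenspace has even dimension `2r`, with `(-1)^r`
the product of the signs. The product `w` of an orthonormal basis of this eigenspace has the same
commutation relations with the vectors as `y`, so `w y` is even and central, hence a scalar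
(`exists_eq_algebraMap_of_commute`), and `y = ± w`. Therefore `y² = w² = (-1)^r`
(`spin_mul_self_of_involution`). Comparing the signs gives `e^{iμ(η)} = z² = ∏ e^{iαⱼ(η)}`, that is,
`e^{iβ(2η)} = 1`.

Only the value of the action at the single element `exp(η)` is used, so `J` need not be compatible
with the metric or the orientation, and no path lifting to `Spin(2m)` is needed.
-/

/-! ### Even central elements of a Clifford algebra -/

section CliffordCenter

open CliffordAlgebra

variable {V : Type*} [AddCommGroup V] [Module ℝ V] {Q : QuadraticForm ℝ V} {κ : Type*} {f : κ → V}

lemma involute_mem_adjoin {S : Set κ} {a : CliffordAlgebra Q}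
    (ha : a ∈ Algebra.adjoin ℝ ((fun i => ι Q (f i)) '' S)) :
    involute a ∈ Algebra.adjoin ℝ ((fun i => ι Q (f i)) '' S) := by
  induction ha using Algebra.adjoin_induction with
  | mem y hy =>
    obtain ⟨i, hi, rfl⟩ := hy
    rw [involute_ι]
    exact neg_mem (Algebra.subset_adjoin ⟨i, hi, rfl⟩)
  | algebraMap r => simp
  | add y z _ _ h h' => rw [map_add]; exact add_mem h h'
  | mul y z _ _ h h' => rw [map_mul]; exact mul_mem h h'

lemma mul_ι_eq_ι_mul_involute {S : Set κ} {v : V}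
    (hv : ∀ i ∈ S, ι Q (f i) * ι Q v = -(ι Q v * ι Q (f i))) {a : CliffordAlgebra Q}
    (ha : a ∈ Algebra.adjoin ℝ ((fun i => ι Q (f i)) '' S)) :
    a * ι Q v = ι Q v * involute a := by
  induction ha using Algebra.adjoin_induction with
  | mem y hy =>
    obtain ⟨i, hi, rfl⟩ := hy
    simp [hv i hi]
  | algebraMap r => simp [Algebra.commutes]
  | add y z _ _ h h' => simp [add_mul, mul_add, h, h']
  | mul y z _ _ h h' => rw [map_mul, mul_assoc, h', ← mul_assoc, h, mul_assoc]

/-- A new generator that anticommutes with the old ones and squares to `-1` enters an element of the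
generated algebra at most linearly, and can be moved to the left. -/
lemma exists_eq_add_ι_mul {S : Set κ} {j : κ} (hj : ι Q (f j) * ι Q (f j) = -1)
    (hv : ∀ i ∈ S, ι Q (f i) * ι Q (f j) = -(ι Q (f j) * ι Q (f i))) {a : CliffordAlgebra Q}
    (ha : a ∈ Algebra.adjoin ℝ ((fun i => ι Q (f i)) '' insert j S)) :
    ∃ b ∈ Algebra.adjoin ℝ ((fun i => ι Q (f i)) '' S),
      ∃ c ∈ Algebra.adjoin ℝ ((fun i => ι Q (f i)) '' S), a = b + ι Q (f j) * c := by
  induction ha using Algebra.adjoin_induction with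
  | mem y hy =>
    obtain ⟨i, rfl | hi, rfl⟩ := hy
    · exact ⟨0, zero_mem _, 1, one_mem _, by simp⟩
    · exact ⟨_, Algebra.subset_adjoin ⟨i, hi, rfl⟩, 0, zero_mem _, by simp⟩
  | algebraMap r => exact ⟨_, Subalgebra.algebraMap_mem _ r, 0, zero_mem _, by simp⟩
  | add y z _ _ h h' =>
    obtain ⟨b, hb, c, hc, rfl⟩ := h
    obtain ⟨b', hb', c', hc', rfl⟩ := h'
    exact ⟨b + b', add_mem hb hb', c + c', add_mem hc hc', by rw [mul_add]; abel⟩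
  | mul y z _ _ h h' =>
    obtain ⟨b, hb, c, hc, rfl⟩ := h
    obtain ⟨b', hb', c', hc', rfl⟩ := h'
    refine ⟨b * b' - involute c * c',
      sub_mem (mul_mem hb hb') (mul_mem (involute_mem_adjoin hc) hc'),
      involute b * c' + c * b',
      add_mem (mul_mem (involute_mem_adjoin hb) hc') (mul_mem hc hb'), ?_⟩
    have h1 : b * (ι Q (f j) * c') = ι Q (f j) * (involute b * c') := by
      rw [← mul_assoc, mul_ι_eq_ι_mul_involute hv hb, mul_assoc]
    have h2 : ι Q (f j) * c * (ι Q (f j) * c') = -(involute c * c') := by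
      rw [mul_assoc, ← mul_assoc c, mul_ι_eq_ι_mul_involute hv hc, mul_assoc, ← mul_assoc, hj,
        neg_one_mul]
    rw [add_mul, mul_add, mul_add, h1, h2]
    noncomm_ring

/-- In the algebra generated by finitely many anticommuting square roots of `-1`, the only even
elements that commute with the generators are the scalars: such an element does not involve any
of the generators. -/
lemma exists_eq_algebraMap_of_commute (S : Finset κ)
    (hsq : ∀ i, ι Q (f i) * ι Q (f i) = -1)
    (hanti : ∀ i j, i ≠ j → ι Q (f i) * ι Q (f j) = -(ι Q (f j) * ι Q (f i)))
    {a : CliffordAlgebra Q} (ha : a ∈ Algebra.adjoin ℝ ((fun i => ι Q (f i)) '' (S : Set κ)))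
    (heven : involute a = a) (hcomm : ∀ i ∈ S, a * ι Q (f i) = ι Q (f i) * a) :
    ∃ r : ℝ, a = algebraMap ℝ _ r := by
  classical
  induction S using Finset.induction_on generalizing a with
  | empty =>
    simp only [Finset.coe_empty, Set.image_empty, Algebra.adjoin_empty] at ha
    obtain ⟨r, hr⟩ := Algebra.mem_bot.1 ha
    exact ⟨r, hr.symm⟩
  | insert j S hjS ih =>
    have hv : ∀ i ∈ (S : Set κ), ι Q (f i) * ι Q (f j) = -(ι Q (f j) * ι Q (f i)) :=
      fun i hi => hanti i j (fun h => hjS (h ▸ hi))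
    rw [Finset.coe_insert] at ha
    obtain ⟨b, hb, c, hc, rfl⟩ := exists_eq_add_ι_mul (hsq j) hv ha
    have h1 := hcomm j (Finset.mem_insert_self j S)
    have h2 : involute b - ι Q (f j) * involute c = b + ι Q (f j) * c := by
      simpa [sub_eq_add_neg] using heven
    have h3 : ι Q (f j) * involute b - involute c = ι Q (f j) * b - c := by
      rw [add_mul, mul_add, mul_assoc (ι Q (f j)) c, mul_ι_eq_ι_mul_involute hv hb,
        mul_ι_eq_ι_mul_involute hv hc, ← mul_assoc (ι Q (f j)), ← mul_assoc (ι Q (f j)), hsq] at h1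
      simpa [sub_eq_add_neg] using h1
    -- Evenness, multiplied by `f j`, differs from commutation with `f j` by the sign at `c`.
    have h4 : ι Q (f j) * involute b + involute c = ι Q (f j) * b - c := by
      have := congrArg (ι Q (f j) * ·) h2
      simp only [mul_sub, mul_add, ← mul_assoc, hsq] at this
      simpa [sub_eq_add_neg] using this
    have h5 : (2 : ℝ) • involute c = 0 := by
      rw [two_smul, ← sub_eq_zero.2 (h4.trans h3.symm)]
      abel
    have hc0 : c = 0 := by
      have h6 := (smul_eq_zero.1 h5).resolve_left two_ne_zero
      rw [← involute_involute c, h6, map_zero]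
    subst hc0
    simp only [mul_zero, add_zero] at heven hcomm ⊢
    exact ih hb heven fun i hi => hcomm i (Finset.mem_insert_of_mem hi)

/-! ### Products of anticommuting vectors -/

lemma ι_mul_prod_of_notMem
    (hanti : ∀ i j, i ≠ j → ι Q (f i) * ι Q (f j) = -(ι Q (f j) * ι Q (f i)))
    {l : List κ} {i : κ} (hi : i ∉ l) :
    ι Q (f i) * (l.map fun j => ι Q (f j)).prod =
      (-1 : ℝ) ^ l.length • ((l.map fun j => ι Q (f j)).prod * ι Q (f i)) := by
  induction l with
  | nil => simp
  | cons j l ih =>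
    simp only [List.mem_cons, not_or] at hi
    rw [List.map_cons, List.prod_cons, ← mul_assoc, hanti i j hi.1, neg_mul, mul_assoc, ih hi.2]
    simp [mul_assoc, pow_succ]

lemma ι_mul_prod_of_mem
    (hanti : ∀ i j, i ≠ j → ι Q (f i) * ι Q (f j) = -(ι Q (f j) * ι Q (f i)))
    {l : List κ} (hl : l.Nodup) {i : κ} (hi : i ∈ l) :
    ι Q (f i) * (l.map fun j => ι Q (f j)).prod =
      -((-1 : ℝ) ^ l.length • ((l.map fun j => ι Q (f j)).prod * ι Q (f i))) := by
  classical
  induction l with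
  | nil => simp at hi
  | cons j l ih =>
    rw [List.nodup_cons] at hl
    by_cases hij : i = j
    · subst hij
      rw [List.map_cons, List.prod_cons]
      nth_rw 1 [ι_mul_prod_of_notMem hanti hl.1]
      simp [mul_assoc, pow_succ]
    · rw [List.map_cons, List.prod_cons, ← mul_assoc, hanti i j hij, neg_mul, mul_assoc,
        ih hl.2 ((List.mem_cons.1 hi).resolve_left hij)]
      simp [mul_assoc, pow_succ]

lemma prod_mul_prod_eq_neg_one_pow
    (hsq : ∀ i, ι Q (f i) * ι Q (f i) = -1)
    (hanti : ∀ i j, i ≠ j → ι Q (f i) * ι Q (f j) = -(ι Q (f j) * ι Q (f i)))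
    {l : List κ} (hl : l.Nodup) :
    (l.map fun j => ι Q (f j)).prod * (l.map fun j => ι Q (f j)).prod =
      (-1 : ℝ) ^ (∑ i ∈ Finset.range (l.length + 1), i) • 1 := by
  induction l with
  | nil => simp
  | cons j l ih =>
    rw [List.nodup_cons] at hl
    rw [List.map_cons, List.prod_cons]
    nth_rw 1 [ι_mul_prod_of_notMem hanti hl.1]
    rw [smul_mul_assoc, mul_assoc, ← mul_assoc (ι Q (f j)) (ι Q (f j)), hsq, neg_one_mul, mul_neg,
      ih hl.2, List.length_cons, Finset.sum_range_succ _ (l.length + 1), pow_add,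
      pow_succ _ l.length, smul_neg, smul_smul, ← neg_smul]
    ring_nf

lemma prod_mul_reverse_prod
    (hsq : ∀ i, ι Q (f i) * ι Q (f i) = -1) (l : List κ) :
    (l.map fun j => ι Q (f j)).prod * reverse (l.map fun j => ι Q (f j)).prod =
      (-1 : ℝ) ^ l.length • 1 := by
  induction l with
  | nil => simp
  | cons j l ih =>
    rw [List.map_cons, List.prod_cons, reverse.map_mul, reverse_ι, mul_assoc,
      ← mul_assoc _ _ (ι Q (f j)), ih]
    simp [hsq, pow_succ]

lemma involute_prod_ι (l : List κ) :
    involute (l.map fun j => ι Q (f j)).prod =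
      (-1 : ℝ) ^ l.length • (l.map fun j => ι Q (f j)).prod := by
  induction l with
  | nil => simp
  | cons j l ih =>
    rw [List.map_cons, List.prod_cons, map_mul, involute_ι, ih]
    simp [pow_succ]

end CliffordCenter

/-! ### Lifts of orthogonal involutions to `Spin(k)` -/

section SpinInvolution

open CliffordAlgebra

variable {k : ℕ}

lemma negNormForm_apply (v : EuclideanSpace ℝ (Fin k)) : negNormForm k v = -inner ℝ v v := by
  simp [negNormForm]

lemma ι_mul_ι_add_swap_eq_inner (v w : EuclideanSpace ℝ (Fin k)) :
    ι (negNormForm k) v * ι (negNormForm k) w + ι (negNormForm k) w * ι (negNormForm k) v =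
      algebraMap ℝ _ (-(2 * inner ℝ v w)) := by
  rw [ι_mul_ι_add_swap]
  congr 1
  simp only [QuadraticMap.polar, negNormForm_apply, inner_add_left, inner_add_right,
    real_inner_comm v w]
  ring

lemma spin_mul_reverse (x : Spin k) : (x : Cl k) * reverse (x : Cl k) = 1 := by
  have h := spinGroup.mul_star_self_of_mem x.2
  rwa [star_def, spinGroup.involute_eq x.2] at h

lemma spin_reverse_mul (x : Spin k) : reverse (x : Cl k) * (x : Cl k) = 1 := by
  have h := spinGroup.star_mul_self_of_mem x.2
  rwa [star_def, spinGroup.involute_eq x.2] at h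

lemma spin_mul_ι (x : Spin k) (v : EuclideanSpace ℝ (Fin k)) :
    (x : Cl k) * ι (negNormForm k) v = ι (negNormForm k) (spinRotation x v) * x := by
  rw [ι_spinRotation, mul_assoc _ _ (x : Cl k), spin_reverse_mul, mul_one]

/-- Rotations preserve the inner product, so eigenvectors for `-1` and `1` are orthogonal. -/
lemma inner_eq_zero_of_spinRotation (x : Spin k) {v w : EuclideanSpace ℝ (Fin k)}
    (hv : spinRotation x v = -v) (hw : spinRotation x w = w) : inner ℝ v w = 0 := by
  have hxv := spin_mul_ι x v
  have hxw := spin_mul_ι x w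
  rw [hv, map_neg, neg_mul] at hxv
  rw [hw] at hxw
  have h : (x : Cl k) * (algebraMap ℝ _ (-(2 * inner ℝ v w))) =
      -(algebraMap ℝ (Cl k) (-(2 * inner ℝ v w)) * x) := by
    rw [← ι_mul_ι_add_swap_eq_inner, mul_add, ← mul_assoc, ← mul_assoc, hxv, hxw, add_mul, neg_mul,
      mul_assoc _ (x : Cl k), mul_assoc _ (x : Cl k), hxv, hxw]
    noncomm_ring
  have h' := congrArg (· * reverse (x : Cl k)) h
  simp only [← Algebra.commutes, neg_mul, mul_assoc, spin_mul_reverse, mul_one] at h'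
  rw [← map_neg] at h'
  have := (algebraMap ℝ (Cl k)).injective h'
  linarith

/-- If `λ(x)` is the orthogonal involution with `(-1)`-eigenspace `V` of dimension `2r`, then
`x² = (-1)^r`: up to sign, `x` is the product of an orthonormal basis of `V`. -/
lemma spin_mul_self_of_involution (x : Spin k) (V : Submodule ℝ (EuclideanSpace ℝ (Fin k)))
    (hV : ∀ v ∈ V, spinRotation x v = -v) (hV' : ∀ v ∈ Vᗮ, spinRotation x v = v) {r : ℕ}
    (hr : Module.finrank ℝ V = 2 * r) : (x : Cl k) * x = (-1 : ℝ) ^ r • 1 := by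
  let b := ((stdOrthonormalBasis ℝ V).prod (stdOrthonormalBasis ℝ Vᗮ)).map
    V.orthogonalDecomposition.symm
  let f : Fin (Module.finrank ℝ V) ⊕ Fin (Module.finrank ℝ Vᗮ) → EuclideanSpace ℝ (Fin k) := b
  have hl (i) : f (Sum.inl i) ∈ V := by simp [f, b]
  have hr' (i) : f (Sum.inr i) ∈ Vᗮ := by simp [f, b]
  have hsq (i) : ι (negNormForm k) (f i) * ι (negNormForm k) (f i) = -1 := by
    rw [ι_sq_scalar, negNormForm_apply, real_inner_self_eq_norm_sq, b.norm_eq_one]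
    simp
  have hanti (i j) (hij : i ≠ j) : ι (negNormForm k) (f i) * ι (negNormForm k) (f j) =
      -(ι (negNormForm k) (f j) * ι (negNormForm k) (f i)) := by
    rw [eq_neg_iff_add_eq_zero, ι_mul_ι_add_swap_eq_inner, b.inner_eq_zero hij]
    simp
  have htop : Algebra.adjoin ℝ ((fun i => ι (negNormForm k) (f i)) ''
      ((Finset.univ : Finset (Fin (Module.finrank ℝ V) ⊕ Fin (Module.finrank ℝ Vᗮ))) : Set _)) =
      ⊤ := by
    rw [eq_top_iff, ← adjoin_range_ι, Algebra.adjoin_le_iff]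
    rintro _ ⟨v, rfl⟩
    rw [← b.sum_repr v, map_sum]
    refine sum_mem fun i _ => ?_
    rw [map_smul]
    exact Subalgebra.smul_mem _ (Algebra.subset_adjoin
      (Set.mem_image_of_mem _ (Finset.mem_coe.2 (Finset.mem_univ i)))) _
  let l := (List.finRange (Module.finrank ℝ V)).map
    (Sum.inl : _ → Fin (Module.finrank ℝ V) ⊕ Fin (Module.finrank ℝ Vᗮ))
  have hlen : l.length = 2 * r := by simp [l, hr]
  have hnd : l.Nodup := (List.nodup_finRange _).map Sum.inl_injective
  set w := (l.map fun j => ι (negNormForm k) (f j)).prod with hw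
  have hww : w * w = (-1 : ℝ) ^ r • 1 := by
    rw [hw, prod_mul_prod_eq_neg_one_pow hsq hanti hnd, hlen, Finset.sum_range_id,
      show (2 * r + 1) * (2 * r + 1 - 1) / 2 = 2 * (r * r) + r by
        rw [Nat.add_sub_cancel]; apply Nat.div_eq_of_eq_mul_left two_pos; ring,
      pow_add, pow_mul]
    simp
  have hwr : w * reverse w = 1 := by
    rw [hw, prod_mul_reverse_prod hsq, hlen, pow_mul]
    simp
  have heven : involute (w * (x : Cl k)) = w * (x : Cl k) := by
    rw [map_mul, spinGroup.involute_eq x.2, hw, involute_prod_ι, hlen, pow_mul]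
    simp
  have hcomm (i) : w * (x : Cl k) * ι (negNormForm k) (f i) =
      ι (negNormForm k) (f i) * (w * (x : Cl k)) := by
    rw [mul_assoc, spin_mul_ι]
    rcases i with i | i
    · have h := ι_mul_prod_of_mem hanti hnd (i := Sum.inl i) (by simp [l])
      rw [hlen, pow_mul, ← hw] at h
      simp only [even_two, Even.neg_pow, one_pow, one_smul] at h
      rw [hV _ (hl i), map_neg, neg_mul, mul_neg, ← mul_assoc, ← mul_assoc, h, neg_mul]
    · have h := ι_mul_prod_of_notMem hanti (l := l) (i := Sum.inr i) (by simp [l])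
      rw [hlen, pow_mul, ← hw] at h
      simp only [even_two, Even.neg_pow, one_pow, one_smul] at h
      rw [hV' _ (hr' i), ← mul_assoc, ← mul_assoc, h]
  obtain ⟨c, hc⟩ := exists_eq_algebraMap_of_commute Finset.univ hsq hanti
    (htop ▸ Algebra.mem_top) heven fun i _ => hcomm i
  have hx : (x : Cl k) = ((-1) ^ r * c) • w := by
    have h := congrArg ((-1 : ℝ) ^ r • w * ·) hc
    simp only [smul_mul_assoc, ← mul_assoc, hww, smul_smul, one_mul, ← pow_add, ← two_mul, pow_mul,
      Algebra.algebraMap_eq_smul_one, mul_smul_comm, mul_one] at h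
    simpa [mul_comm c] using h
  have hs : ((-1 : ℝ) ^ r * c) * ((-1) ^ r * c) = 1 := by
    have h := spin_mul_reverse x
    rw [hx, map_smul, smul_mul_smul_comm, hwr, ← Algebra.algebraMap_eq_smul_one,
      ← map_one (algebraMap ℝ (Cl k))] at h
    exact (algebraMap ℝ (Cl k)).injective h
  rw [hx, smul_mul_smul_comm, hs, hww, one_smul]

end SpinInvolution

/-! ### A criterion for membership in the weight lattice -/

lemma circleExp_sum {κ : Type*} (s : Finset κ) (u : κ → ℝ) :
    Circle.exp (∑ i ∈ s, u i) = ∏ i ∈ s, Circle.exp (u i) := by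
  induction s using Finset.cons_induction with
  | empty => simp
  | cons i s hi ih => rw [Finset.sum_cons, Finset.prod_cons, Circle.exp_add, ih]

/-- A functional is in the weight lattice once it takes values in `2πℤ` on the
generators of the kernel `(2πℤ)^n` of the exponential map. -/
lemma mem_weightLattice_of_exp_two_pi {n : ℕ} (β : Module.Dual ℝ (Fin n → ℝ))
    (h : ∀ i, Circle.exp (β ((2 * Real.pi) • Pi.single i 1)) = 1) : β ∈ weightLattice n := by
  have h' : ∀ i, ∃ d : ℤ, β (Pi.single i 1) = d := by
    intro i
    obtain ⟨d, hd⟩ := Circle.exp_eq_one.1 (h i)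
    refine ⟨d, ?_⟩
    rw [map_smul, smul_eq_mul, mul_comm] at hd
    exact mul_right_cancel₀ (by positivity) hd
  choose d hd using h'
  refine ⟨∏ i, (zpowGroupHom (d i)).comp (Pi.evalMonoidHom (fun _ : Fin n => Circle) i), ?_, ?_⟩
  · rw [MonoidHom.coe_finsetProd, Finset.prod_fn]
    exact continuous_finsetProd _ fun i _ => (continuous_apply i).zpow (d i)
  · intro θ
    rw [LinearMap.pi_apply_eq_sum_univ β θ, MonoidHom.finsetProd_apply, circleExp_sum]
    refine Finset.prod_congr rfl fun i _ => ?_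
    have hi : (fun j => if i = j then (1 : ℝ) else 0) = Pi.single i 1 := by
      ext j; simp [Pi.single_apply, eq_comm]
    rw [hi, hd, smul_eq_mul, mul_comm, ← zsmul_eq_mul, Circle.exp_zsmul]
    rfl

/-! ### The isotropy action in a `Spin^c` frame -/

lemma mk_isotropyMap {k n : ℕ} {M : Type*} [TopologicalSpace M]
    [ChartedSpace (EuclideanSpace ℝ (Fin k)) M] [MulAction (Torus n) M]
    (x : M) (hx : x ∈ MulAction.fixedPoints (Torus n) M) (t : Torus n)
    (v : TangentSpace (𝓡 k) x) :
    (⟨x, isotropyMap x hx t v⟩ : TangentBundle (𝓡 k) M) =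
      ⟨t • x, mfderiv (𝓡 k) (𝓡 k) (fun y : M => t • y) x v⟩ := by
  have key (y : M) (h : y = x) (L : TangentSpace (𝓡 k) x →L[ℝ] TangentSpace (𝓡 k) y) :
      (⟨x, (congrArg (fun y : M => TangentSpace (𝓡 k) x →L[ℝ] TangentSpace (𝓡 k) y) h).mp L v⟩ :
        TangentBundle (𝓡 k) M) = ⟨y, L v⟩ := by
    subst h
    rfl
  exact key (t • x) (hx t) _

section Frame

variable {k n : ℕ} {M : Type*} [TopologicalSpace M]
  [ChartedSpace (EuclideanSpace ℝ (Fin k)) M] [IsManifold (𝓡 k) ∞ M] [MulAction (Torus n) M]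
  {g : RiemMetric k M} {o : ∀ x : M, Orientation ℝ (TangentSpace (𝓡 k) x) (Fin k)} {P : Type*}

/-- If `t · p = p · a` for a point `p` over the fixed point `x`, then the frame `Λ(p)` conjugates
the isotropy action of `t` to the rotation `λ^c(a)`. -/
lemma EquivariantSpinCStructure.exists_frame (S : EquivariantSpinCStructure n g o P) {x : M}
    (hx : x ∈ MulAction.fixedPoints (Torus n) M) {p : P} (hp : S.proj p = x) :
    ∃ F : EuclideanSpace ℝ (Fin k) ≃ₗ[ℝ] TangentSpace (𝓡 k) x,
      ∀ (t : Torus n) (a : SpinC k), S.tsmul t p = S.act p a →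
        ∀ v, isotropyMap x hx t (F v) = F (spinCRotation a v) := by
  have hb : (S.toFrame p).base = x := (S.base_toFrame p).trans hp
  subst hb
  refine ⟨(S.toFrame p).frame, fun t a hta v => ?_⟩
  have h := (mk_isotropyMap _ hx t ((S.toFrame p).frame v)).trans (S.toFrame_tsmul t p v).symm
  rw [hta, S.toFrame_act p a v] at h
  exact Bundle.TotalSpace.mk_injective _ h

/-- If `t · p = p · [y, z]` for a point `p` over the fixed point `x`, then `t` acts on the fibre
of the determinant line bundle as `z²`. -/
lemma EquivariantSpinCStructure.IsDetWeight.det_eq {S : EquivariantSpinCStructure n g o P} {x : M}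
    {μ : Module.Dual ℝ (Fin n → ℝ)} (hμ : S.IsDetWeight x μ) {p : P} (hp : S.proj p = x)
    {θ : Fin n → ℝ} {a : SpinC k} (ha : S.tsmul (torusExp θ) p = S.act p a) :
    spinCDet k a = Circle.exp (μ θ) := by
  have h := hμ θ (Quotient.mk _ (p, 1)) hp
  obtain ⟨c, hc1, hc2⟩ := Quotient.exact h
  replace hc1 : S.tsmul (torusExp θ) p = S.act p c := hc1
  replace hc2 : (Circle.exp (μ θ) : ℂ) * 1 = (spinCDet k c : ℂ) * 1 := hc2
  obtain ⟨_, _, huniq⟩ := S.existsUnique_act p (S.act p a) (S.proj_act p a).symm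
  have hca : c = a := (huniq c (hc1.symm.trans ha)).trans (huniq a rfl).symm
  rw [mul_one, mul_one, hca] at hc2
  exact Circle.ext hc2.symm

end Frame

/-! ### Diagonal rotations with doubled eigenvalues -/

/-- If `λ(x)` acts on a basis `e_1, …, e_m, e'_1, …, e'_m` of `ℝ^k`, not necessarily orthogonal,
by signs that agree on `e_j` and `e'_j`, then `x²` is the product of the `m` signs. -/
lemma spin_mul_self_of_basis {k m : ℕ} (x : Spin k)
    (b : Module.Basis (Fin m ⊕ Fin m) ℝ (EuclideanSpace ℝ (Fin k))) (ε : Fin m → ℝ)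
    (hε : ∀ j, ε j = 1 ∨ ε j = -1)
    (hl : ∀ j, spinRotation x (b (Sum.inl j)) = ε j • b (Sum.inl j))
    (hr : ∀ j, spinRotation x (b (Sum.inr j)) = ε j • b (Sum.inr j)) :
    (x : Cl k) * x = (∏ j, ε j) • 1 := by
  classical
  let s : Finset (Fin m) := Finset.univ.filter fun j => ε j = -1
  let u : s ⊕ s → Fin m ⊕ Fin m := Sum.map Subtype.val Subtype.val
  have hu : Function.Injective u :=
    Sum.map_injective.2 ⟨Subtype.val_injective, Subtype.val_injective⟩
  let V := Submodule.span ℝ (Set.range (b ∘ u))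
  have hdim : Module.finrank ℝ V = 2 * s.card := by
    rw [finrank_span_eq_card (b.linearIndependent.comp u hu), Fintype.card_sum, Fintype.card_coe,
      two_mul]
  have hprod : ∏ j, ε j = (-1) ^ s.card := by
    have : ∀ j, ε j = if ε j = -1 then -1 else 1 := fun j => by
      split_ifs with h
      · exact h
      · exact (hε j).resolve_right h
    rw [Finset.prod_congr rfl fun j _ => this j, Finset.prod_ite]
    simp [s]
  have hVneg : ∀ v ∈ V, spinRotation x v = -v := by
    intro v hv
    induction hv using Submodule.span_induction with
    | mem v hv =>
      obtain ⟨j | j, rfl⟩ := hv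
      · have hj := (Finset.mem_filter.1 j.2).2
        simpa [u, hj] using hl j
      · have hj := (Finset.mem_filter.1 j.2).2
        simpa [u, hj] using hr j
    | zero => simp
    | add v w _ _ h h' => rw [map_add, h, h', neg_add]
    | smul c v _ h => rw [map_smul, h, smul_neg]
  have hdecomp : ∀ v, ∃ w ∈ V, spinRotation x (v - w) = v - w := by
    intro v
    induction b.mem_span v using Submodule.span_induction with
    | mem v hv =>
      obtain ⟨j, rfl⟩ := hv
      have hcase : b j ∈ V ∨ spinRotation x (b j) = b j := by
        rcases j with j | j
        · rcases hε j with h | h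
          · right; rw [hl, h, one_smul]
          · left
            exact Submodule.subset_span ⟨Sum.inl ⟨j, by simp [s, h]⟩, rfl⟩
        · rcases hε j with h | h
          · right; rw [hr, h, one_smul]
          · left
            exact Submodule.subset_span ⟨Sum.inr ⟨j, by simp [s, h]⟩, rfl⟩
      rcases hcase with h | h
      · exact ⟨b j, h, by simp⟩
      · exact ⟨0, zero_mem _, by simpa using h⟩
    | zero => exact ⟨0, zero_mem _, by simp⟩
    | add v v' _ _ h h' =>
      obtain ⟨w, hw, e⟩ := h
      obtain ⟨w', hw', e'⟩ := h'
      refine ⟨w + w', add_mem hw hw', ?_⟩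
      rw [add_sub_add_comm, map_add, e, e']
    | smul c v _ h =>
      obtain ⟨w, hw, e⟩ := h
      exact ⟨c • w, Submodule.smul_mem _ _ hw, by rw [← smul_sub, map_smul, e]⟩
  have hVpos : ∀ v ∈ Vᗮ, spinRotation x v = v := by
    intro v hv
    obtain ⟨w, hw, e⟩ := hdecomp v
    -- The `V`-component `w` of `v` is orthogonal both to `v` and to the fixed vector `v - w`.
    have h0 : inner ℝ w w = 0 := by
      have h1 := inner_eq_zero_of_spinRotation x (hVneg w hw) e
      rw [inner_sub_right, (Submodule.mem_orthogonal V v).1 hv w hw, zero_sub, neg_eq_zero] at h1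
      exact h1
    rw [inner_self_eq_zero] at h0
    simpa [h0] using e
  rw [spin_mul_self_of_involution x V hVneg hVpos hdim, hprod]

/-! ### The weights at a fixed point -/

theorem lemma4p1 {m n : ℕ} {M : Type*} [TopologicalSpace M] [T2Space M] [CompactSpace M]
    [ChartedSpace (EuclideanSpace ℝ (Fin (2 * m))) M] [IsManifold (𝓡 (2 * m)) ∞ M]
    (g : RiemMetric (2 * m) M)
    (o : ∀ x : M, Orientation ℝ (TangentSpace (𝓡 (2 * m)) x) (Fin (2 * m)))
    (ho : IsManifoldOrientation o)
    [MulAction (Torus n) M] [ContMDiffSMul (torusModel n) (𝓡 (2 * m)) ∞ (Torus n) M]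
    (hg : ActsByIsometries (Torus n) g)
    {P : Type*} (S : EquivariantSpinCStructure n g o P)
    (x : M) (hx : x ∈ MulAction.fixedPoints (Torus n) M)
    (J : TangentSpace (𝓡 (2 * m)) x →ₗ[ℝ] TangentSpace (𝓡 (2 * m)) x)
    (hJ : IsInvariantComplexStructure x hx J)
    (α : Fin m → Module.Dual ℝ (Fin n → ℝ)) (hα : IsIsotropyWeights x hx J α)
    (μ : Module.Dual ℝ (Fin n → ℝ)) (hμ : S.IsDetWeight x μ) :
    (1 / 2 : ℝ) • (μ - ∑ j, α j) ∈ weightLattice n := by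
  refine mem_weightLattice_of_exp_two_pi _ fun i => ?_
  -- `torusExp` maps `2η` to `1`, while `η` is half of this kernel element.
  set η : Fin n → ℝ := Real.pi • Pi.single i 1 with hη
  have hηη : ((2 * Real.pi) • Pi.single i 1 : Fin n → ℝ) = (2 : ℝ) • η := by
    rw [hη, smul_smul]
  have hexp : (torusExp ((2 : ℝ) • η) : Torus n) = 1 := by
    rw [← hηη]
    ext l
    by_cases hl : l = i
    · subst hl; simp [torusExp]
    · simp [torusExp, hl]
  have hsq : (torusExp η : Torus n) * torusExp η = 1 := by
    rw [← hexp, two_smul]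
    ext l
    simp [torusExp, Circle.exp_add]
  obtain ⟨σ, hσ, hxσ⟩ := S.cover x
  have hp : S.proj (σ.2 x) = x := S.proj_section σ hσ x hxσ
  set p := σ.2 x
  obtain ⟨F, hF⟩ := S.exists_frame hx hp
  obtain ⟨a, ha, -⟩ := S.existsUnique_act p (S.tsmul (torusExp η) p)
    (by rw [S.proj_tsmul, hp]; exact (hx _).symm)
  -- The square of the torus element `torusExp η` is `1`, hence so is that of `a`.
  have haa : a * a = 1 := by
    obtain ⟨_, _, huniq⟩ := S.existsUnique_act p p rfl
    refine (huniq _ ?_).trans (huniq _ (S.act_one p)).symm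
    beta_reduce
    rw [S.act_mul, ha, ← S.tsmul_act, ha, ← S.mul_tsmul, hsq, S.one_tsmul]
  have hdet := hμ.det_eq hp ha.symm
  have hrot := hF _ _ ha.symm
  have hone (v : TangentSpace (𝓡 (2 * m)) x) :
      isotropyMap x hx (torusExp ((2 : ℝ) • η)) v = v := by
    obtain ⟨v, rfl⟩ := F.surjective v
    rw [hF _ 1 (by rw [hexp, S.one_tsmul, S.act_one])]
    simp
  obtain ⟨e, ⟨b, hb⟩, he⟩ := hα
  have hbl (j) : b (Sum.inl j) = e j := congrFun hb _
  have hbr (j) : b (Sum.inr j) = J (e j) := congrFun hb _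
  have hcos (j) : Real.cos (2 * α j η) = 1 := by
    have h := he ((2 : ℝ) • η) j
    rw [hone, map_smul, smul_eq_mul, ← hbr, ← hbl] at h
    simpa using (congrArg (fun v => b.repr v (Sum.inl j)) h).symm
  have hsin (j) : Real.sin (α j η) = 0 := by
    have h := hcos j
    rw [Real.cos_two_mul, Real.cos_sq'] at h
    exact pow_eq_zero_iff two_ne_zero |>.1 (by linarith)
  have hε (j) : Real.cos (α j η) = 1 ∨ Real.cos (α j η) = -1 :=
    (Real.sin_eq_zero_iff_cos_eq.1 (hsin j))
  obtain ⟨⟨y, z⟩, rfl⟩ := QuotientGroup.mk_surjective a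
  have hrot' (v) : isotropyMap x hx (torusExp η) (F v) = F (spinRotation y v) := hrot v
  have hdet' : z ^ 2 = Circle.exp (μ η) := hdet
  have he' (j) : isotropyMap x hx (torusExp η) (e j) = Real.cos (α j η) • e j := by
    rw [he, hsin, zero_smul, add_zero]
  have hyy : (y : Cl (2 * m)) * y = (∏ j, Real.cos (α j η)) • 1 := by
    refine spin_mul_self_of_basis y (b.map F.symm) _ hε (fun j => ?_) fun j => ?_
    · apply F.injective
      rw [← hrot', map_smul, b.map_apply, F.apply_symm_apply, hbl, he']
    · apply F.injective
      rw [← hrot', map_smul, b.map_apply, F.apply_symm_apply, hbr, ← hJ.2, he', map_smul]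
  -- Membership of `(y², z²)` in `{(1, 1), (-1, -1)}` ties the sign of `z²` to that of `y²`.
  have hker : ((y, z) * (y, z) : Spin (2 * m) × Circle) ∈ spinCKernel (2 * m) :=
    (QuotientGroup.eq_one_iff _).1 haa
  have hz : ((z ^ 2 : Circle) : ℂ) = ((∏ j, Real.cos (α j η) : ℝ) : ℂ) := by
    rcases hker with ⟨h1, h2⟩ | ⟨h1, h2⟩
    · replace h1 : (y : Cl (2 * m)) * y = 1 := h1
      replace h2 : ((z * z : Circle) : ℂ) = 1 := h2
      rw [hyy, ← Algebra.algebraMap_eq_smul_one, ← map_one (algebraMap ℝ (Cl (2 * m)))] at h1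
      rw [sq, h2, (algebraMap ℝ (Cl (2 * m))).injective h1, Complex.ofReal_one]
    · replace h1 : (y : Cl (2 * m)) * y = -1 := h1
      replace h2 : ((z * z : Circle) : ℂ) = -1 := h2
      rw [hyy, ← Algebra.algebraMap_eq_smul_one, ← map_one (algebraMap ℝ (Cl (2 * m))),
        ← map_neg] at h1
      rw [sq, h2, (algebraMap ℝ (Cl (2 * m))).injective h1]
      simp
  have hα' : ∏ j, Circle.exp (α j η) = z ^ 2 := by
    apply Circle.ext
    rw [hz, Complex.ofReal_prod]
    refine (map_prod Circle.coeHom _ _).trans (Finset.prod_congr rfl fun j _ => ?_)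
    change ((Circle.exp (α j η) : Circle) : ℂ) = _
    rw [Circle.coe_exp, Complex.exp_mul_I, ← Complex.ofReal_cos,
      ← Complex.ofReal_sin, hsin]
    simp
  have hβ : ((1 / 2 : ℝ) • (μ - ∑ j, α j)) ((2 : ℝ) • η) = μ η - ∑ j, α j η := by
    simp [LinearMap.sum_apply]
  rw [hηη, hβ, Circle.exp_sub, circleExp_sum, hα', ← hdet', div_self']
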